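/- Let $G=(V,E)$ be a finite bipartite graph with parts $V_1,V_2$, let $h\ge 1$ be an integer and $n=|V|$. Number the vertices so that $V_1=\{v_1,\dots,v_s\}$, $V_2=\{v_{s+1},\dots,v_n\}$ and $j\ge i+3$ for every edge $\{v_i,v_j\}\in E$ with $i<j$. Put $y=10n^2$. "Joining two vertices by a path of length $m$" means adding a path of length $m$ between them whose $m-1$ inner vertices are new. Construct a graph $G'$ as follows. (a) *Skeleton.* Take vertices $u^t_1,\dots,u^t_n$ and $u^b_1,\dots,u^b_n$; for $1\le i<n$ join $u^t_i$ to $u^t_{i+1}$, and $u^b_i$ to $u^b_{i+1}$, by a path of length $y$. The path $u^t_1-\dots-u^t_n$ is the top-line. To each of $u^t_1,u^t_n,u^b_1,u^b_n$ attach a new path on three vertices by making its middle vertex adjacent to that vertex. (b) *Vertex gadgets.* For each $i\in\{1,\dots,n\}$ add a cycle $a^t_i-l^i_1-\dots-l^i_n-a^b_i-r^i_n-\dots-r^i_1-a^t_i$ of length $2n+2$; join $a^t_i$ to $u^t_i$ and $a^b_i$ to $u^b_i$ by paths of length $y$. (c) *Edge gadgets.* For each edge $\{v_i,v_j\}\in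 E$ with $i<j$ join $r^i_j$ to $r^j_i$ by a path of length $(j-i+\frac32)y$; let $w^{i,j}_1$ and $w^{i,j}_2$ be the vertices of this path at distance $y$ along it from $r^i_j$ and from $r^j_i$, respectively. Let $u^t_{i,j,1}$ (respectively $u^t_{i,j,2}$) be the vertex on the top-line between $u^t_i$ and $u^t_j$ at distance $j$ from $u^t_i$ (respectively at distance $i$ from $u^t_j$). Join $w^{i,j}_1$ to $u^t_{i,j,1}$ and $w^{i,j}_2$ to $u^t_{i,j,2}$ by paths of length $y$. A metric basis of a graph is a set $L$ of vertices such that for any two distinct vertices $u,w$ there is $x\in L$ with $\operatorname{dist}(x,u)\ne\operatorname{dist}(x,w)$. A dominating set of $G$ is a set $D\subseteq V$ that meets the closed neighbourhood $N[v]$ of every $v\in V$. If $G'$ has a metric basis of size at most $k=h+4$, then $G$ has a dominating set of size at most $h$. -/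

import Mathlib

namespace MetricDim

/-- `D` is a dominating set: every closed neighbourhood `N[x]` meets `D`. -/
def IsDominatingSet {V : Type*} (G : SimpleGraph V) (D : Finset V) : Prop :=
  ∀ x : V, ∃ d ∈ D, d = x ∨ G.Adj x d

/-- `L` is a metric basis: each pair of distinct vertices is separated by some vertex of `L`. -/
def IsMetricBasis {V : Type*} (G : SimpleGraph V) (L : Finset V) : Prop :=
  ∀ u w : V, u ≠ w → ∃ x ∈ L, G.dist x u ≠ G.dist x w

/-- `(G, h)` is a yes-instance of (Bipartite) Dominating Set. -/
def DominatingSetYes {V : Type*} (G : SimpleGraph V) (h : ℕ) : Prop :=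
  ∃ D : Finset V, D.card ≤ h ∧ IsDominatingSet G D

/-- `(G, k)` is a yes-instance of Metric Dimension. -/
def MetricDimensionYes {V : Type*} (G : SimpleGraph V) (k : ℕ) : Prop :=
  ∃ L : Finset V, L.card ≤ k ∧ IsMetricBasis G L

/-- The vertex at position `p` of a path of length `len` from `a` to `b`, whose inner vertices
are, in this order, `inner 0, inner 1, …`. -/
def pathPoint {W : Type*} (a b : W) (len : ℕ) (inner : Fin (len - 1) → W) (p : ℕ) : W :=
  if p = 0 then a
  else if hp : p - 1 < len - 1 then inner ⟨p - 1, hp⟩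
  else b

/-- `x` and `z` are consecutive on the path of length `len` from `a` to `b` with inner
vertices `inner`. -/
def PathStep {W : Type*} (a b : W) (len : ℕ) (inner : Fin (len - 1) → W) (x z : W) : Prop :=
  ∃ p < len, x = pathPoint a b len inner p ∧ z = pathPoint a b len inner (p + 1)

/-- The length `y = 10 n²` of a `y`-path. -/
def yLen (n : ℕ) : ℕ := 10 * n ^ 2

/-- The two lines of the skeletal structure, top and bottom. -/
inductive Line
  | t
  | b

/-- The two ends of a line, left and right. -/
inductive Side
  | l
  | r

/-- The edges `{v_i, v_j}` of `G`, each listed once, as the pair `(i, j)` with `i < j`.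
Here and below indices start at `0`: the vertex `v_i` of the usual numbering `1, …, n` is
`i - 1 : Fin n`. -/
def GEdge {n : ℕ} (G : SimpleGraph (Fin n)) : Type :=
  {e : Fin n × Fin n // G.Adj e.1 e.2 ∧ e.1 < e.2}

namespace GEdge

variable {n : ℕ} {G : SimpleGraph (Fin n)}

/-- The smaller index of an edge. -/
def i (e : GEdge G) : Fin n := e.1.1

/-- The larger index of an edge. -/
def j (e : GEdge G) : Fin n := e.1.2

/-- The length `(j - i + 3/2) y` of the path between `r^i_j` and `r^j_i` (`y` is even). -/
def len (e : GEdge G) : ℕ := (e.j.val - e.i.val) * yLen n + 3 * yLen n / 2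

end GEdge

/-- The vertices of the constructed graph. -/
inductive Vtx {n : ℕ} (G : SimpleGraph (Fin n)) : Type
  /-- the vertex at position `p` of the top- or bottom-line, counted from its left endpoint -/
  | line (c : Line) (p : Fin ((n - 1) * yLen n + 1))
  /-- the middle vertex of the `P₃` at an end of a line -/
  | mid (c : Line) (d : Side)
  /-- the two other vertices of the `P₃` at an end of a line -/
  | leaf (c : Line) (d : Side) (m : Bool)
  /-- the anchors `a^t_i`, `a^b_i` -/
  | anchor (c : Line) (i : Fin n)
  /-- the inner vertices of the `y`-path from `a^c_i` to `u^c_i` -/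
  | anchorInner (c : Line) (i : Fin n) (p : Fin (yLen n - 1))
  /-- the left-vertices `l^i_1, …, l^i_n` -/
  | left (i : Fin n) (j : Fin n)
  /-- the right-vertices `r^i_1, …, r^i_n` -/
  | right (i : Fin n) (j : Fin n)
  /-- the inner vertices of the path from `r^i_j` to `r^j_i` in an edge-gadget -/
  | edgeInner (e : GEdge G) (p : Fin (e.len - 1))
  /-- the inner vertices of the `y`-path from `w^{i,j}_1` to `u^t_{i,j,1}` -/
  | tlInner (e : GEdge G) (p : Fin (yLen n - 1))
  /-- the inner vertices of the `y`-path from `w^{i,j}_2` to `u^t_{i,j,2}` -/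
  | trInner (e : GEdge G) (p : Fin (yLen n - 1))

theorem mul_yLen_lt {n : ℕ} (i : Fin n) : i.val * yLen n < (n - 1) * yLen n + 1 :=
  Nat.lt_succ_of_le (Nat.mul_le_mul_right _ (Nat.le_sub_one_of_lt i.isLt))

theorem GEdge.pos_lt {n : ℕ} {G : SimpleGraph (Fin n)} (e : GEdge G) :
    e.i.val * yLen n + (e.j.val + 1) < (n - 1) * yLen n + 1 := by
  have hij : e.i.val < e.j.val := e.2.2
  have hj : e.j.val < n := e.j.isLt
  have hy : n ≤ yLen n := by unfold yLen; nlinarith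
  have h1 : (e.i.val + 1) * yLen n ≤ (n - 1) * yLen n := Nat.mul_le_mul_right _ (by omega)
  rw [Nat.add_mul] at h1
  omega

namespace Vtx

variable {n : ℕ} {G : SimpleGraph (Fin n)}

/-- The vertex `u^t_i` or `u^b_i`. -/
def u (c : Line) (i : Fin n) : Vtx G := line c ⟨i.val * yLen n, mul_yLen_lt i⟩

/-- The endpoints of a line: `u^c_1` on the left and `u^c_n` on the right. -/
def endpoint (c : Line) : Side → Vtx G
  | .l => line c 0
  | .r => line c (Fin.last _)

/-- The vertex `u^t_{i,j,1}` of the top-line, between `u^t_i` and `u^t_j`, at distance `j`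
(in the numbering from `1`) from `u^t_i`. -/
def u1 (e : GEdge G) : Vtx G :=
  line .t ⟨e.i.val * yLen n + (e.j.val + 1), e.pos_lt⟩

/-- The vertex `u^t_{i,j,2}` of the top-line, between `u^t_i` and `u^t_j`, at distance `i`
(in the numbering from `1`) from `u^t_j`. -/
def u2 (e : GEdge G) : Vtx G :=
  line .t ⟨e.j.val * yLen n - (e.i.val + 1),
    lt_of_le_of_lt (Nat.sub_le _ _) (mul_yLen_lt e.j)⟩

/-- The vertex at position `p` of the path from `r^i_j` to `r^j_i`. -/
def edgePoint (e : GEdge G) (p : ℕ) : Vtx G :=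
  pathPoint (right e.i e.j) (right e.j e.i) e.len (edgeInner e) p

/-- The vertex `w^{i,j}_1`, at distance `y` from `r^i_j` on that path. -/
def w1 (e : GEdge G) : Vtx G := edgePoint e (yLen n)

/-- The vertex `w^{i,j}_2`, at distance `y` from `r^j_i` on that path. -/
def w2 (e : GEdge G) : Vtx G := edgePoint e (e.len - yLen n)

end Vtx

/-- The edges of the constructed graph, each given in one orientation. -/
inductive Step {n : ℕ} (G : SimpleGraph (Fin n)) : Vtx G → Vtx G → Prop
  /-- consecutive vertices of the top- or bottom-line -/
  | line (c : Line) (p q : Fin ((n - 1) * yLen n + 1)) (hpq : p.val + 1 = q.val) :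
      Step G (.line c p) (.line c q)
  /-- an endpoint is adjacent to the middle vertex of its `P₃` -/
  | mid (c : Line) (d : Side) : Step G (.endpoint c d) (.mid c d)
  /-- the two edges of a `P₃` -/
  | leaf (c : Line) (d : Side) (m : Bool) : Step G (.mid c d) (.leaf c d m)
  /-- the `y`-path from the anchor `a^c_i` to `u^c_i` -/
  | anchor (c : Line) (i : Fin n) (x z : Vtx G)
      (hs : PathStep (.anchor c i) (.u c i) (yLen n) (.anchorInner c i) x z) : Step G x z
  /-- the left half `a^t_i - l^i_1 - … - l^i_n - a^b_i` of the cycle -/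
  | left (i : Fin n) (x z : Vtx G)
      (hs : PathStep (.anchor .t i) (.anchor .b i) (n + 1) (.left i) x z) : Step G x z
  /-- the right half `a^t_i - r^i_1 - … - r^i_n - a^b_i` of the cycle -/
  | right (i : Fin n) (x z : Vtx G)
      (hs : PathStep (.anchor .t i) (.anchor .b i) (n + 1) (.right i) x z) : Step G x z
  /-- the path from `r^i_j` to `r^j_i` of an edge-gadget -/
  | edge (e : GEdge G) (x z : Vtx G)
      (hs : PathStep (.right e.i e.j) (.right e.j e.i) e.len (.edgeInner e) x z) : Step G x z
  /-- the `y`-path from `w^{i,j}_1` to `u^t_{i,j,1}` -/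
  | tl (e : GEdge G) (x z : Vtx G)
      (hs : PathStep (.w1 e) (.u1 e) (yLen n) (.tlInner e) x z) : Step G x z
  /-- the `y`-path from `w^{i,j}_2` to `u^t_{i,j,2}` -/
  | tr (e : GEdge G) (x z : Vtx G)
      (hs : PathStep (.w2 e) (.u2 e) (yLen n) (.trInner e) x z) : Step G x z

/-- The graph `G'` constructed from the graph `G` on `{v_1, …, v_n}`. -/
def reductionGraph {n : ℕ} (G : SimpleGraph (Fin n)) : SimpleGraph (Vtx G) :=
  SimpleGraph.fromRel (Step G)

end MetricDim

/-! Each `P₃` at the end of a line has two twin leaves, and only a leaf itself separates such a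
pair. A metric basis therefore contains four leaves, one per line end, and at most `h` other
vertices.

For each `i` the pair `l^i_1`, `r^i_1` must be separated. Around `i` there are two regions outside
of which every vertex has equal distance to both. `LeftZone` is the left half of the cycle of `i`.
`Zone` has three parts: the right half of that cycle, the edge gadgets at `i`, and the gadgets of
the neighbours of `i` with the `y`-paths leaving them. The reason is metric: a walk from `r^i_1`
that leaves `Zone` does so at a vertex that `l^i_1` reaches just as cheaply, through an anchor of
`i` and, if needed, a line (`zone_step`, `edist_le_of_region`). The extra `y/2` in the length of an
edge path makes the crossing to a neighbour's gadget more expensive than the route along the line,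
by more than the size of a cycle.

Conversely, each vertex of `G'` has a home in `G` that dominates every `i` in whose regions it lies
(`exists_home`). The leaves lie in no region, so the homes of the at most `h` other basis vertices
form a dominating set. -/

namespace MetricDim

/-! ### Comparing distances by a region and a potential -/

section General

variable {W : Type*} {H : SimpleGraph W}

/-- If the vertices reachable from `a` through the region `Z` (where `Z x m` bounds the distance
from `a` to `x` inside the region) leave it only at vertices at least as close to `b`, then every
vertex outside the region is at least as close to `b` as to `a`. -/
theorem edist_le_of_region (a b : W) (Z : W → ℕ → Prop) (h0 : Z a 0)
    (hstep : ∀ x z m, H.Adj x z → Z x m → Z z (m + 1) ∨ H.edist z b ≤ (m + 1 : ℕ))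
    (x : W) (hx : ∀ m, ¬ Z x m) : H.edist x b ≤ H.edist x a := by
  -- The induction follows the walk backwards from its end `c`, which will be `a`. Once the second
  -- alternative holds it persists by the triangle inequality, so leaving and re-entering the region
  -- does no harm.
  have key : ∀ {y c : W} (p : H.Walk y c), Z c 0 → Z y p.length ∨ H.edist y b ≤ p.length := by
    intro y c p hc
    induction p with
    | nil => exact Or.inl hc
    | @cons y z c h p ih =>
      rcases ih hc with hz | hz
      · exact hstep z y p.length h.symm hz
      · right
        have h1 : H.edist y z ≤ 1 := (SimpleGraph.edist_eq_one_iff_adj.2 h).le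
        calc H.edist y b ≤ H.edist y z + H.edist z b := SimpleGraph.edist_triangle
          _ ≤ 1 + p.length := add_le_add h1 hz
          _ = ((SimpleGraph.Walk.cons h p).length : ℕ∞) := by
            rw [SimpleGraph.Walk.length_cons]; push_cast; rw [add_comm]
  by_cases hr : H.Reachable x a
  · obtain ⟨p, hp⟩ := hr.exists_walk_length_eq_edist
    rw [← hp]
    exact (key p h0).resolve_left (hx _)
  · rw [SimpleGraph.edist_eq_top_of_not_reachable hr]
    exact le_top

/-- Working with `edist` makes connectedness of the graph unnecessary: if both distances are
infinite, `dist` is 0 on both sides. -/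
theorem dist_eq_of_edist_le {x a b : W} (h₁ : H.edist x a ≤ H.edist x b)
    (h₂ : H.edist x b ≤ H.edist x a) : H.dist x a = H.dist x b := by
  unfold SimpleGraph.dist
  rw [le_antisymm h₁ h₂]

theorem edist_le_of_steps (g : ℕ → W) (len : ℕ) (hg : ∀ p < len, H.edist (g p) (g (p + 1)) ≤ 1)
    (p k : ℕ) (hk : p + k ≤ len) : H.edist (g p) (g (p + k)) ≤ k := by
  induction k with
  | zero => simp
  | succ k ih =>
    calc H.edist (g p) (g (p + (k + 1)))
      _ ≤ H.edist (g p) (g (p + k)) + H.edist (g (p + k)) (g (p + k + 1)) :=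
          SimpleGraph.edist_triangle
      _ ≤ k + 1 := add_le_add (ih (by omega)) (hg _ (by omega))
      _ = ((k + 1 : ℕ) : ℕ∞) := by push_cast; rfl

theorem edist_le_trans {x z b : W} {k m r : ℕ} (h₁ : H.edist x z ≤ k) (h₂ : H.edist z b ≤ m)
    (hr : k + m ≤ r) : H.edist x b ≤ r :=
  calc H.edist x b ≤ H.edist x z + H.edist z b := SimpleGraph.edist_triangle
    _ ≤ k + m := add_le_add h₁ h₂
    _ ≤ r := by exact_mod_cast hr

end General

/-! ### Positions on a subdivided path -/

section PathPoint

variable {W : Type*} {a b : W} {len : ℕ} {inner : Fin (len - 1) → W}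

@[simp] theorem pathPoint_zero : pathPoint a b len inner 0 = a := by simp [pathPoint]

theorem pathPoint_len (h : 1 ≤ len) : pathPoint a b len inner len = b := by
  have h0 : len ≠ 0 := by omega
  simp [pathPoint, h0]

theorem pathPoint_inner (p : Fin (len - 1)) :
    pathPoint a b len inner (p.val + 1) = inner p := by
  simp [pathPoint]

/-- A property of positions and vertices holds along the path once it holds at both ends and
at the inner vertices. -/
theorem pathPoint_cases {P : ℕ → W → Prop} (h0 : P 0 a) (h1 : P len b)
    (hi : ∀ p : Fin (len - 1), P (p.val + 1) (inner p)) (p : ℕ) (hp : p ≤ len) :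
    P p (pathPoint a b len inner p) := by
  rcases p with _ | p
  · simpa using h0
  · by_cases h : p < len - 1
    · have := hi ⟨p, h⟩
      rw [← pathPoint_inner (a := a) (b := b) (inner := inner)] at this
      exact this
    · have : p + 1 = len := by omega
      rw [this, pathPoint_len (by omega)]
      exact h1

/-- A family `Q` describing a property `Z` of the vertices of a path by their positions, and
stable under moving along the path up to an alternative `E`, makes `Z` stable along the path. -/
theorem PathStep.transfer {Z : W → ℕ → Prop} {E : W → ℕ → Prop} (Q : ℕ → ℕ → Prop)
    (hZ : ∀ p ≤ len, ∀ m, Z (pathPoint a b len inner p) m ↔ Q p m)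
    (hup : ∀ p < len, ∀ m, Q p m → Q (p + 1) (m + 1) ∨ E (pathPoint a b len inner (p + 1)) (m + 1))
    (hdown : ∀ p < len, ∀ m, Q (p + 1) m → Q p (m + 1) ∨ E (pathPoint a b len inner p) (m + 1))
    {x z : W} (hs : PathStep a b len inner x z) (m : ℕ) :
    (Z x m → Z z (m + 1) ∨ E z (m + 1)) ∧ (Z z m → Z x (m + 1) ∨ E x (m + 1)) := by
  obtain ⟨p, hp, rfl, rfl⟩ := hs
  rw [hZ p hp.le, hZ p hp.le, hZ (p + 1) hp, hZ (p + 1) hp]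
  exact ⟨hup p hp m, hdown p hp m⟩

end PathPoint

variable {n : ℕ} {G : SimpleGraph (Fin n)}

/-! ### Distance bounds along lines and paths of the constructed graph -/

theorem edist_le_one_of_step {x z : Vtx G} (h : Step G x z) :
    (reductionGraph G).edist x z ≤ 1 := by
  by_cases hxz : x = z
  · subst hxz; simp
  · exact (SimpleGraph.edist_eq_one_iff_adj.2
      ((SimpleGraph.fromRel_adj _ _ _).2 ⟨hxz, Or.inl h⟩)).le

theorem edist_pathPoint_le {a b : Vtx G} {len : ℕ} {inner : Fin (len - 1) → Vtx G}
    (hs : ∀ x z, PathStep a b len inner x z → Step G x z) {p q : ℕ} (hpq : p ≤ q) (hq : q ≤ len) :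
    (reductionGraph G).edist (pathPoint a b len inner p) (pathPoint a b len inner q)
      ≤ (q - p : ℕ) := by
  have := edist_le_of_steps (H := reductionGraph G) (pathPoint a b len inner) len
    (fun p hp => edist_le_one_of_step (hs _ _ ⟨p, hp, rfl, rfl⟩)) p (q - p) (by omega)
  rwa [show p + (q - p) = q by omega] at this

theorem edist_path_ends_le {a b : Vtx G} {len : ℕ} {inner : Fin (len - 1) → Vtx G}
    (hs : ∀ x z, PathStep a b len inner x z → Step G x z) (h : 1 ≤ len) :
    (reductionGraph G).edist a b ≤ len := by
  have := edist_pathPoint_le hs (Nat.zero_le len) le_rfl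
  rwa [pathPoint_zero, pathPoint_len h] at this

theorem edist_line_le (c : Line) (p q : Fin ((n - 1) * yLen n + 1)) :
    (reductionGraph G).edist (.line c p) (.line c q)
      ≤ ((p.val - q.val) + (q.val - p.val) : ℕ) := by
  have key : ∀ p q : Fin ((n - 1) * yLen n + 1), p ≤ q →
      (reductionGraph G).edist (.line c p) (.line c q) ≤ (q.val - p.val : ℕ) := by
    intro p q hpq
    -- Clamping at the right end turns the line into a sequence indexed by all of `ℕ`.
    let g : ℕ → Vtx G := fun k => .line c ⟨min k ((n - 1) * yLen n), by omega⟩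
    have hg : ∀ p : Fin ((n - 1) * yLen n + 1), g p.val = .line c p := by
      intro p
      have : min p.val ((n - 1) * yLen n) = p.val := by omega
      simp [g, this]
    have := edist_le_of_steps (H := reductionGraph G) g ((n - 1) * yLen n)
      (fun k hk => edist_le_one_of_step (Step.line c _ _ (by simp only []; omega)))
      p.val (q.val - p.val) (by omega)
    rwa [show p.val + (q.val - p.val) = q.val by have := Fin.le_def.1 hpq; omega, hg, hg] at this
  rcases le_total p q with h | h
  · have h' := Fin.le_def.1 h
    rw [show p.val - q.val + (q.val - p.val) = q.val - p.val by omega]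
    exact key p q h
  · have h' := Fin.le_def.1 h
    rw [show p.val - q.val + (q.val - p.val) = p.val - q.val by omega, SimpleGraph.edist_comm]
    exact key q p h

/-- The absolute difference of two indices. -/
def gap (i k : Fin n) : ℕ := (k.val - i.val) + (i.val - k.val)

theorem gap_mul (i k : Fin n) (y : ℕ) :
    gap i k * y = (k.val * y - i.val * y) + (i.val * y - k.val * y) := by
  unfold gap
  rw [Nat.add_mul, Nat.sub_mul, Nat.sub_mul]

/-- The length of the edge path between the vertex gadgets of `i` and `k`. -/
def crossLen (i k : Fin n) : ℕ := gap i k * yLen n + 3 * yLen n / 2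

/-- All later comparisons rest on this slack: half of `y` outweighs the `n + 1` that may be lost on
a cycle or on a short offset along the top-line. -/
theorem yLen_bounds (i : Fin n) : n + 1 ≤ yLen n / 2 ∧ 2 * (yLen n / 2) = yLen n := by
  have hn : 1 ≤ n := by have := i.isLt; omega
  have h : yLen n = 2 * (5 * n ^ 2) := by unfold yLen; ring
  rw [h, Nat.mul_div_cancel_left _ (by norm_num)]
  exact ⟨by nlinarith, rfl⟩

theorem GEdge.adj (e : GEdge G) : G.Adj e.i e.j := e.2.1

theorem GEdge.lt (e : GEdge G) : e.i.val < e.j.val := e.2.2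

theorem GEdge.len_eq_crossLen_left (e : GEdge G) : e.len = crossLen e.i e.j := by
  unfold GEdge.len crossLen gap
  have := e.lt
  rw [show e.i.val - e.j.val = 0 by omega, Nat.add_zero]

theorem GEdge.len_eq_crossLen_right (e : GEdge G) : e.len = crossLen e.j e.i := by
  rw [e.len_eq_crossLen_left]; unfold crossLen gap; rw [Nat.add_comm (e.j.val - e.i.val)]

theorem GEdge.len_eq (e : GEdge G) :
    e.len + e.i.val * yLen n = e.j.val * yLen n + yLen n + yLen n / 2 := by
  have h := (yLen_bounds e.i).2
  have h1 : e.i.val * yLen n ≤ e.j.val * yLen n := Nat.mul_le_mul_right _ e.lt.le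
  unfold GEdge.len
  rw [Nat.sub_mul]
  omega

theorem GEdge.mul_add_le (e : GEdge G) : e.i.val * yLen n + yLen n ≤ e.j.val * yLen n := by
  rw [← Nat.succ_mul]; exact Nat.mul_le_mul_right _ e.lt

/-! ### Upper bounds for distances to a vertex of the cycle of `i` -/

section Near

variable (i : Fin n)

/-- The first index. -/
def firstIdx : Fin n := ⟨0, by have := i.isLt; omega⟩

theorem edist_line_target_le {t : Vtx G} (ht : (reductionGraph G).edist (.anchor .t i) t ≤ (1 : ℕ))
    (p : Fin ((n - 1) * yLen n + 1)) :
    (reductionGraph G).edist (.line .t p) t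
      ≤ ((p.val - i.val * yLen n) + (i.val * yLen n - p.val) + yLen n + 1 : ℕ) := by
  have hy := yLen_bounds i
  have h2 : (reductionGraph G).edist (.u .t i) (.anchor .t i) ≤ yLen n := by
    rw [SimpleGraph.edist_comm]
    exact edist_path_ends_le (Step.anchor .t i) (by omega)
  exact edist_le_trans (edist_line_le .t p _) (edist_le_trans h2 ht le_rfl) (by
    simp only []; omega)

theorem edist_u_target_le {t : Vtx G} (ht : (reductionGraph G).edist (.anchor .t i) t ≤ (1 : ℕ))
    (hb : (reductionGraph G).edist (.anchor .b i) t ≤ n) (c : Line) (k : Fin n) :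
    (reductionGraph G).edist (.u c k) t ≤ (gap i k * yLen n + yLen n + n : ℕ) := by
  have hy := yLen_bounds i
  have hc : (reductionGraph G).edist (.anchor c i) t ≤ n := by
    cases c
    · exact ht.trans (by exact_mod_cast (by have := i.isLt; omega : 1 ≤ n))
    · exact hb
  have h2 : (reductionGraph G).edist (.u c i) (.anchor c i) ≤ yLen n := by
    rw [SimpleGraph.edist_comm]
    exact edist_path_ends_le (Step.anchor c i) (by omega)
  refine edist_le_trans (edist_line_le c _ _) (edist_le_trans h2 hc le_rfl) ?_
  rw [gap_mul]
  simp only []; omega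

/-- The route goes up to the top-line, along it to `u^t_i`, and down to the top anchor; `n` absorbs
the offset of `u^t_{i,j,1}`. -/
theorem edist_w1_target_le {t : Vtx G} (ht : (reductionGraph G).edist (.anchor .t i) t ≤ (1 : ℕ))
    (e : GEdge G) : (reductionGraph G).edist (.w1 e) t
      ≤ (gap i e.i * yLen n + 2 * yLen n + n + 1 : ℕ) := by
  have hy := yLen_bounds i
  refine edist_le_trans (edist_path_ends_le (Step.tl e) (by omega))
    (edist_line_target_le i ht _) ?_
  have := e.j.isLt
  rw [gap_mul]
  simp only []; omega

theorem edist_w2_target_le {t : Vtx G} (ht : (reductionGraph G).edist (.anchor .t i) t ≤ (1 : ℕ))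
    (e : GEdge G) : (reductionGraph G).edist (.w2 e) t
      ≤ (gap i e.j * yLen n + 2 * yLen n + n + 1 : ℕ) := by
  have hy := yLen_bounds i
  refine edist_le_trans (edist_path_ends_le (Step.tr e) (by omega))
    (edist_line_target_le i ht _) ?_
  have := e.i.isLt
  rw [gap_mul]
  simp only []; omega

theorem edist_anchor_left :
    (reductionGraph G).edist (.anchor .t i) (.left i (firstIdx i)) ≤ (1 : ℕ) ∧
    (reductionGraph G).edist (.anchor .b i) (.left i (firstIdx i)) ≤ n := by
  have hn := i.isLt
  have h1 := edist_pathPoint_le (Step.left (G := G) i) (p := 0) (q := 1) (by omega) (by omega)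
  have h2 := edist_pathPoint_le (Step.left (G := G) i) (p := 1) (q := n + 1) (by omega) (by omega)
  have h3 : pathPoint (.anchor .t i) (.anchor .b i) (n + 1) (Vtx.left (G := G) i) 1
      = .left i (firstIdx i) := pathPoint_inner (len := n + 1) (firstIdx i)
  rw [h3] at h1 h2
  rw [pathPoint_zero] at h1
  rw [pathPoint_len (by omega), SimpleGraph.edist_comm] at h2
  exact ⟨h1, h2⟩

theorem edist_anchor_right :
    (reductionGraph G).edist (.anchor .t i) (.right i (firstIdx i)) ≤ (1 : ℕ) ∧
    (reductionGraph G).edist (.anchor .b i) (.right i (firstIdx i)) ≤ n := by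
  have hn := i.isLt
  have h1 := edist_pathPoint_le (Step.right (G := G) i) (p := 0) (q := 1) (by omega) (by omega)
  have h2 := edist_pathPoint_le (Step.right (G := G) i) (p := 1) (q := n + 1) (by omega) (by omega)
  have h3 : pathPoint (.anchor .t i) (.anchor .b i) (n + 1) (Vtx.right (G := G) i) 1
      = .right i (firstIdx i) := pathPoint_inner (len := n + 1) (firstIdx i)
  rw [h3] at h1 h2
  rw [pathPoint_zero] at h1
  rw [pathPoint_len (by omega), SimpleGraph.edist_comm] at h2
  exact ⟨h1, h2⟩

end Near

/-! ### The region around the right half of a cycle -/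

/-- The description of `Zone` by positions on the path from `r^i_j` to `r^j_i`. -/
def EdgeZone (i : Fin n) (e : GEdge G) (p m : ℕ) : Prop :=
  (e.i = i ∧ e.j.val + p ≤ m) ∨ (e.j = i ∧ e.i.val + (e.len - p) ≤ m) ∨
  (G.Adj i e.i ∧ p < yLen n ∧ e.i.val + crossLen i e.i + p ≤ m) ∨
  (G.Adj i e.j ∧ e.len - p < yLen n ∧ e.j.val + crossLen i e.j + (e.len - p) ≤ m)

/-- The region around the right half of the cycle of `i` whose vertices may be closer to `r^i_1`
than to `l^i_1`, with a bound `m` for a potential that grows by at most one along an edge. -/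
def Zone (i : Fin n) : Vtx G → ℕ → Prop
  | .line _ _, _ => False
  | .mid _ _, _ => False
  | .leaf _ _ _, _ => False
  -- The potential counts the way from `r^i_1` to the entry point of the neighbour's gadget and then
  -- stays constant, since the slack makes progress inside the gadget irrelevant.
  | .anchor _ k, m => G.Adj i k ∧ k.val + crossLen i k ≤ m
  | .anchorInner _ k _, m => G.Adj i k ∧ k.val + crossLen i k ≤ m
  | .left k _, m => G.Adj i k ∧ k.val + crossLen i k ≤ m
  | .right k q, m => (k = i ∧ q.val ≤ m) ∨ (G.Adj i k ∧ k.val + crossLen i k ≤ m)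
  | .edgeInner e p, m => EdgeZone i e (p.val + 1) m
  | .tlInner e p, m => (e.i = i ∧ e.j.val + yLen n + (p.val + 1) ≤ m) ∨
      (e.j = i ∧ e.i.val + (e.len - yLen n) + (p.val + 1) ≤ m)
  | .trInner e p, m => (e.i = i ∧ e.j.val + (e.len - yLen n) + (p.val + 1) ≤ m) ∨
      (e.j = i ∧ e.i.val + yLen n + (p.val + 1) ≤ m)

theorem zone_edgePoint (i : Fin n) (e : GEdge G) (p : ℕ) (hp : p ≤ e.len) (m : ℕ) :
    Zone i (Vtx.edgePoint e p) m ↔ EdgeZone i e p m := by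
  have hy := yLen_bounds i
  have hl := e.len_eq
  have hm := e.mul_add_le
  refine pathPoint_cases (P := fun p x => Zone i x m ↔ EdgeZone i e p m) ?_ ?_ ?_ p hp
  · have hf : ¬ (e.len < yLen n) := by omega
    simp only [Zone, EdgeZone, hf, false_and, and_false, or_false, Nat.add_zero, Nat.sub_zero]
    constructor
    · rintro (⟨h, h'⟩ | ⟨h, h'⟩)
      · exact Or.inl ⟨h, h'⟩
      · exact Or.inr (Or.inr ⟨h, by omega, h'⟩)
    · rintro (⟨h, h'⟩ | ⟨h, h'⟩ | ⟨h, _, h'⟩)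
      · exact Or.inl ⟨h, h'⟩
      -- At an end of the path, having crossed all of it from `i` is the same as being in the gadget
      -- of a neighbour of `i`.
      · subst h
        exact Or.inr ⟨e.adj.symm, by rwa [← e.len_eq_crossLen_right]⟩
      · exact Or.inr ⟨h, h'⟩
  · have hf : ¬ (e.len < yLen n) := by omega
    simp only [Zone, EdgeZone, hf, false_and, and_false, false_or, Nat.add_zero, Nat.sub_self]
    constructor
    · rintro (⟨h, h'⟩ | ⟨h, h'⟩)
      · exact Or.inr (Or.inl ⟨h, h'⟩)
      · exact Or.inr (Or.inr ⟨h, by omega, h'⟩)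
    · rintro (⟨h, h'⟩ | ⟨h, h'⟩ | ⟨h, _, h'⟩)
      · subst h
        exact Or.inr ⟨e.adj, by rwa [← e.len_eq_crossLen_left]⟩
      · exact Or.inl ⟨h, h'⟩
      · exact Or.inr ⟨h, h'⟩
  · intro p
    rfl

/-! ### Leaving a region is never cheaper from its own side -/

section Closure

variable (i : Fin n)

/-- The distance from `z` to `l^i_1` is at most `m`. -/
def NearLeft (z : Vtx G) (m : ℕ) : Prop :=
  (reductionGraph G).edist z (.left i (firstIdx i)) ≤ m

theorem NearLeft.mono {i : Fin n} {z : Vtx G} {m m' : ℕ} (h : NearLeft i z m) (hm : m ≤ m') :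
    NearLeft i z m' :=
  h.trans (by exact_mod_cast hm)

theorem nearLeft_line (p : Fin ((n - 1) * yLen n + 1)) :
    NearLeft (G := G) i (.line .t p)
      ((p.val - i.val * yLen n) + (i.val * yLen n - p.val) + yLen n + 1) :=
  edist_line_target_le i (edist_anchor_left i).1 p

theorem zone_anchor_path (c : Line) (k : Fin n) {x z : Vtx G}
    (hs : PathStep (.anchor c k) (.u c k) (yLen n) (.anchorInner c k) x z) (m : ℕ) :
    (Zone i x m → Zone i z (m + 1) ∨ NearLeft i z (m + 1)) ∧
    (Zone i z m → Zone i x (m + 1) ∨ NearLeft i x (m + 1)) := by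
  have hy := yLen_bounds i
  refine PathStep.transfer
    (fun p m => p < yLen n ∧ G.Adj i k ∧ k.val + crossLen i k ≤ m) ?_ ?_ ?_ hs m
  · intro p hp m
    refine pathPoint_cases (P := fun p x => Zone i x m ↔
      p < yLen n ∧ G.Adj i k ∧ k.val + crossLen i k ≤ m) ?_ ?_ ?_ p hp
    · simp only [Zone, show 0 < yLen n by omega, true_and]
    · simp [Zone, Vtx.u]
    · intro p
      simp only [Zone, show p.val + 1 < yLen n by omega, true_and]
  · rintro p hp m ⟨_, ha, hm⟩
    rcases Nat.lt_or_ge (p + 1) (yLen n) with h | h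
    · exact Or.inl ⟨h, ha, by omega⟩
    · right
      rw [show p + 1 = yLen n by omega, pathPoint_len (by omega)]
      -- Both routes to `u^c_k` contain a gap term and a `y`-path; the `y/2` left over in `crossLen`
      -- beats `n`.
      refine NearLeft.mono (edist_u_target_le i (edist_anchor_left i).1 (edist_anchor_left i).2 c k)
        ?_
      unfold crossLen at hm
      omega
  · rintro p hp m ⟨_, ha, hm⟩
    exact Or.inl ⟨hp, ha, by omega⟩

theorem zone_left_path (k : Fin n) {x z : Vtx G}
    (hs : PathStep (.anchor .t k) (.anchor .b k) (n + 1) (.left k) x z) (m : ℕ) :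
    (Zone i x m → Zone i z (m + 1) ∨ NearLeft i z (m + 1)) ∧
    (Zone i z m → Zone i x (m + 1) ∨ NearLeft i x (m + 1)) := by
  refine PathStep.transfer
    (fun _ m => G.Adj i k ∧ k.val + crossLen i k ≤ m) ?_ ?_ ?_ hs m
  · intro p hp m
    exact pathPoint_cases (P := fun _ x => Zone i x m ↔
      G.Adj i k ∧ k.val + crossLen i k ≤ m) Iff.rfl Iff.rfl (fun _ => Iff.rfl) p hp
  · rintro p hp m ⟨ha, hm⟩
    exact Or.inl ⟨ha, by omega⟩
  · rintro p hp m ⟨ha, hm⟩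
    exact Or.inl ⟨ha, by omega⟩

theorem zone_right_path (k : Fin n) {x z : Vtx G}
    (hs : PathStep (.anchor .t k) (.anchor .b k) (n + 1) (.right k) x z) (m : ℕ) :
    (Zone i x m → Zone i z (m + 1) ∨ NearLeft i z (m + 1)) ∧
    (Zone i z m → Zone i x (m + 1) ∨ NearLeft i x (m + 1)) := by
  refine PathStep.transfer
    (fun p m => (k = i ∧ 1 ≤ p ∧ p ≤ n ∧ p ≤ m + 1) ∨
      (G.Adj i k ∧ k.val + crossLen i k ≤ m)) ?_ ?_ ?_ hs m
  · intro p hp m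
    refine pathPoint_cases (P := fun p x => Zone i x m ↔ (k = i ∧ 1 ≤ p ∧ p ≤ n ∧ p ≤ m + 1) ∨
      (G.Adj i k ∧ k.val + crossLen i k ≤ m)) ?_ ?_ ?_ p hp
    · simp [Zone]
    · simp [Zone]
    · intro p
      have : p.val + 1 ≤ n := by omega
      simp [Zone, this]
  · rintro p hp m (⟨rfl, h1, h2, h3⟩ | ⟨ha, hm⟩)
    · rcases Nat.lt_or_ge p n with h | h
      · exact Or.inl (Or.inl ⟨rfl, by omega, by omega, by omega⟩)
      -- The region is left at `a^b_i`, which is at most `n` steps from `l^i_1`; the potential has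
      -- reached `n` as well.
      · right
        rw [show p + 1 = n + 1 by omega, pathPoint_len (by omega)]
        exact NearLeft.mono (edist_anchor_left k).2 (by omega)
    · exact Or.inl (Or.inr ⟨ha, by omega⟩)
  · rintro p hp m (⟨rfl, h1, h2, h3⟩ | ⟨ha, hm⟩)
    · rcases Nat.eq_zero_or_pos p with h | h
      · right
        rw [h, pathPoint_zero]
        exact NearLeft.mono (edist_anchor_left k).1 (by omega)
      · exact Or.inl (Or.inl ⟨rfl, by omega, by omega, by omega⟩)
    · exact Or.inl (Or.inr ⟨ha, by omega⟩)

theorem zone_edge_path (e : GEdge G) {x z : Vtx G}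
    (hs : PathStep (.right e.i e.j) (.right e.j e.i) e.len (.edgeInner e) x z) (m : ℕ) :
    (Zone i x m → Zone i z (m + 1) ∨ NearLeft i z (m + 1)) ∧
    (Zone i z m → Zone i x (m + 1) ∨ NearLeft i x (m + 1)) := by
  have hy := yLen_bounds i
  have hl := e.len_eq
  have hlt := e.mul_add_le
  refine PathStep.transfer (EdgeZone i e) (zone_edgePoint i e) ?_ ?_ hs m
  · rintro p hp m (⟨h, hm⟩ | ⟨h, hm⟩ | ⟨h, h1, hm⟩ | ⟨h, h1, hm⟩)
    · exact Or.inl (Or.inl ⟨h, by omega⟩)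
    · exact Or.inl (Or.inr (Or.inl ⟨h, by omega⟩))
    · rcases Nat.lt_or_ge (p + 1) (yLen n) with h2 | h2
      · exact Or.inl (Or.inr (Or.inr (Or.inl ⟨h, h2, by omega⟩)))
      · right
        -- An initial segment starting in a neighbour's gadget ends at `w^{i,j}_1`. There the
        -- potential exceeds the gap term by at least `5y/2`, against `2y + n + 1` by way of the
        -- top-line.
        rw [show p + 1 = yLen n by omega]
        refine NearLeft.mono (edist_w1_target_le i (edist_anchor_left i).1 e) ?_
        unfold crossLen at hm
        omega
    · exact Or.inl (Or.inr (Or.inr (Or.inr ⟨h, by omega, by omega⟩)))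
  · rintro p hp m (⟨h, hm⟩ | ⟨h, hm⟩ | ⟨h, h1, hm⟩ | ⟨h, h1, hm⟩)
    · exact Or.inl (Or.inl ⟨h, by omega⟩)
    · exact Or.inl (Or.inr (Or.inl ⟨h, by omega⟩))
    · exact Or.inl (Or.inr (Or.inr (Or.inl ⟨h, by omega, by omega⟩)))
    · rcases Nat.lt_or_ge (e.len - p) (yLen n) with h2 | h2
      · exact Or.inl (Or.inr (Or.inr (Or.inr ⟨h, h2, by omega⟩)))
      · right
        rw [show p = e.len - yLen n by omega]
        refine NearLeft.mono (edist_w2_target_le i (edist_anchor_left i).1 e) ?_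
        unfold crossLen at hm
        omega

theorem zone_tl_path (e : GEdge G) {x z : Vtx G}
    (hs : PathStep (.w1 e) (.u1 e) (yLen n) (.tlInner e) x z) (m : ℕ) :
    (Zone i x m → Zone i z (m + 1) ∨ NearLeft i z (m + 1)) ∧
    (Zone i z m → Zone i x (m + 1) ∨ NearLeft i x (m + 1)) := by
  have hy := yLen_bounds i
  have hl := e.len_eq
  have hlt := e.mul_add_le
  have hj := e.j.isLt
  refine PathStep.transfer
    (fun p m => p < yLen n ∧ ((e.i = i ∧ e.j.val + yLen n + p ≤ m) ∨
      (e.j = i ∧ e.i.val + (e.len - yLen n) + p ≤ m))) ?_ ?_ ?_ hs m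
  · intro p hp m
    refine pathPoint_cases (P := fun p x => Zone i x m ↔
      p < yLen n ∧ ((e.i = i ∧ e.j.val + yLen n + p ≤ m) ∨
      (e.j = i ∧ e.i.val + (e.len - yLen n) + p ≤ m))) ?_ ?_ ?_ p hp
    -- Edge paths are longer than `2y`, so at `w^{i,j}_1` only the clauses for `i` an end of `e`
    -- survive.
    · have h1 : ¬ (e.len - yLen n < yLen n) := by omega
      rw [Vtx.w1, zone_edgePoint i e _ (by omega)]
      simp [EdgeZone, h1, show 0 < yLen n by omega]
    · simp [Zone, Vtx.u1]
    · intro p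
      simp only [Zone, show p.val + 1 < yLen n by omega, true_and]
  · rintro p hp m ⟨_, hm⟩
    rcases Nat.lt_or_ge (p + 1) (yLen n) with h | h
    · left
      refine ⟨h, ?_⟩
      rcases hm with ⟨h1, h2⟩ | ⟨h1, h2⟩
      · exact Or.inl ⟨h1, by omega⟩
      · exact Or.inr ⟨h1, by omega⟩
    · right
      rw [show p + 1 = yLen n by omega, pathPoint_len (by omega)]
      refine NearLeft.mono (nearLeft_line i _) ?_
      simp only []
      -- Coming from either end of `e`, the walk has paid at least an extra `y/2` compared with the
      -- route from `u^t_{i,j,1}` along the top-line and down to `l^i_1`.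
      rcases hm with ⟨rfl, h2⟩ | ⟨rfl, h2⟩ <;> omega
  · rintro p hp m ⟨_, hm⟩
    left
    refine ⟨hp, ?_⟩
    rcases hm with ⟨h1, h2⟩ | ⟨h1, h2⟩
    · exact Or.inl ⟨h1, by omega⟩
    · exact Or.inr ⟨h1, by omega⟩

theorem zone_tr_path (e : GEdge G) {x z : Vtx G}
    (hs : PathStep (.w2 e) (.u2 e) (yLen n) (.trInner e) x z) (m : ℕ) :
    (Zone i x m → Zone i z (m + 1) ∨ NearLeft i z (m + 1)) ∧
    (Zone i z m → Zone i x (m + 1) ∨ NearLeft i x (m + 1)) := by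
  have hy := yLen_bounds i
  have hl := e.len_eq
  have hlt := e.mul_add_le
  have hi := e.i.isLt
  refine PathStep.transfer
    (fun p m => p < yLen n ∧ ((e.i = i ∧ e.j.val + (e.len - yLen n) + p ≤ m) ∨
      (e.j = i ∧ e.i.val + yLen n + p ≤ m))) ?_ ?_ ?_ hs m
  · intro p hp m
    refine pathPoint_cases (P := fun p x => Zone i x m ↔
      p < yLen n ∧ ((e.i = i ∧ e.j.val + (e.len - yLen n) + p ≤ m) ∨
      (e.j = i ∧ e.i.val + yLen n + p ≤ m))) ?_ ?_ ?_ p hp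
    · have h1 : ¬ (e.len - yLen n < yLen n) := by omega
      have h2 : e.len - (e.len - yLen n) = yLen n := by omega
      rw [Vtx.w2, zone_edgePoint i e _ (by omega)]
      simp [EdgeZone, h1, h2, show 0 < yLen n by omega]
    · simp [Zone, Vtx.u2]
    · intro p
      simp only [Zone, show p.val + 1 < yLen n by omega, true_and]
  · rintro p hp m ⟨_, hm⟩
    rcases Nat.lt_or_ge (p + 1) (yLen n) with h | h
    · left
      refine ⟨h, ?_⟩
      rcases hm with ⟨h1, h2⟩ | ⟨h1, h2⟩
      · exact Or.inl ⟨h1, by omega⟩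
      · exact Or.inr ⟨h1, by omega⟩
    · right
      rw [show p + 1 = yLen n by omega, pathPoint_len (by omega)]
      refine NearLeft.mono (nearLeft_line i _) ?_
      simp only []
      rcases hm with ⟨rfl, h2⟩ | ⟨rfl, h2⟩ <;> omega
  · rintro p hp m ⟨_, hm⟩
    left
    refine ⟨hp, ?_⟩
    rcases hm with ⟨h1, h2⟩ | ⟨h1, h2⟩
    · exact Or.inl ⟨h1, by omega⟩
    · exact Or.inr ⟨h1, by omega⟩

theorem zone_step {x z : Vtx G} (h : Step G x z) (m : ℕ) :
    (Zone i x m → Zone i z (m + 1) ∨ NearLeft i z (m + 1)) ∧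
    (Zone i z m → Zone i x (m + 1) ∨ NearLeft i x (m + 1)) := by
  cases h with
  | line c p q hpq => exact ⟨False.elim, False.elim⟩
  | mid c d => cases d <;> exact ⟨False.elim, False.elim⟩
  | leaf c d b => exact ⟨False.elim, False.elim⟩
  | anchor c k x z hs => exact zone_anchor_path i c k hs m
  | left k x z hs => exact zone_left_path i k hs m
  | right k x z hs => exact zone_right_path i k hs m
  | edge e x z hs => exact zone_edge_path i e hs m
  | tl e x z hs => exact zone_tl_path i e hs m
  | tr e x z hs => exact zone_tr_path i e hs m

theorem edist_left_le_edist_right {x : Vtx G} (hx : ∀ m, ¬ Zone i x m) :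
    (reductionGraph G).edist x (.left i (firstIdx i))
      ≤ (reductionGraph G).edist x (.right i (firstIdx i)) := by
  have h0 : Zone (G := G) i (.right i (firstIdx i)) 0 := Or.inl ⟨rfl, le_rfl⟩
  refine edist_le_of_region _ _ (Zone i) h0 ?_ x hx
  intro x z m h hz
  rcases ((SimpleGraph.fromRel_adj _ _ _).1 h).2 with hs | hs
  · exact (zone_step i hs m).1 hz
  · exact (zone_step i hs m).2 hz

/-! ### The left half of a cycle, which meets the rest only at the anchors -/

/-- The left half of the cycle of `i`, with the distance to `l^i_1` along it. -/
def LeftZone : Vtx G → ℕ → Prop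
  | .left k q, m => k = i ∧ q.val ≤ m
  | _, _ => False

theorem leftZone_left_path (k : Fin n) {x z : Vtx G}
    (hs : PathStep (.anchor .t k) (.anchor .b k) (n + 1) (.left k) x z) (m : ℕ) :
    (LeftZone i x m → LeftZone i z (m + 1) ∨
      (reductionGraph G).edist z (.right i (firstIdx i)) ≤ (m + 1 : ℕ)) ∧
    (LeftZone i z m → LeftZone i x (m + 1) ∨
      (reductionGraph G).edist x (.right i (firstIdx i)) ≤ (m + 1 : ℕ)) := by
  refine PathStep.transfer
    (E := fun z m => (reductionGraph G).edist z (.right i (firstIdx i)) ≤ m)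
    (fun p m => k = i ∧ 1 ≤ p ∧ p ≤ n ∧ p ≤ m + 1) ?_ ?_ ?_ hs m
  · intro p hp m
    refine pathPoint_cases (P := fun p x => LeftZone i x m ↔
      k = i ∧ 1 ≤ p ∧ p ≤ n ∧ p ≤ m + 1) ?_ ?_ ?_ p hp
    · simp [LeftZone]
    · simp [LeftZone]
    · intro p
      have : p.val + 1 ≤ n := by omega
      simp [LeftZone, this]
  · rintro p hp m ⟨rfl, h1, h2, h3⟩
    rcases Nat.lt_or_ge p n with h | h
    · exact Or.inl ⟨rfl, by omega, by omega, by omega⟩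
    · right
      rw [show p + 1 = n + 1 by omega, pathPoint_len (by omega)]
      exact (edist_anchor_right k).2.trans (by exact_mod_cast (by omega : n ≤ m + 1))
  · rintro p hp m ⟨rfl, h1, h2, h3⟩
    rcases Nat.eq_zero_or_pos p with h | h
    · right
      rw [h, pathPoint_zero]
      exact (edist_anchor_right k).1.trans (by exact_mod_cast (by omega : 1 ≤ m + 1))
    · exact Or.inl ⟨rfl, by omega, by omega, by omega⟩

/-- A path none of whose vertices satisfies `Z` has no step at a vertex satisfying `Z`. -/
theorem PathStep.not_of_forall {W : Type*} {Z : W → Prop} {a b : W} {len : ℕ}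
    {inner : Fin (len - 1) → W} (ha : ¬ Z a) (hb : ¬ Z b) (hi : ∀ p, ¬ Z (inner p)) {x z : W}
    (hs : PathStep a b len inner x z) : ¬ Z x ∧ ¬ Z z := by
  obtain ⟨p, hp, rfl, rfl⟩ := hs
  have key := pathPoint_cases (P := fun _ x => ¬ Z x) ha hb hi
  exact ⟨key p hp.le, key (p + 1) hp⟩

theorem edgePoint_cases {Z : Vtx G → Prop} (e : GEdge G) (ha : Z (.right e.i e.j))
    (hb : Z (.right e.j e.i)) (hi : ∀ p, Z (.edgeInner e p)) (p : ℕ) : Z (.edgePoint e p) := by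
  unfold Vtx.edgePoint pathPoint
  split_ifs
  · exact ha
  · exact hi _
  · exact hb

theorem leftZone_step {x z : Vtx G} (h : Step G x z) (m : ℕ) :
    (LeftZone i x m → LeftZone i z (m + 1) ∨
      (reductionGraph G).edist z (.right i (firstIdx i)) ≤ (m + 1 : ℕ)) ∧
    (LeftZone i z m → LeftZone i x (m + 1) ∨
      (reductionGraph G).edist x (.right i (firstIdx i)) ≤ (m + 1 : ℕ)) := by
  have hw : ∀ (e : GEdge G) (p : ℕ), ¬ LeftZone i (.edgePoint e p) m :=
    fun e => edgePoint_cases (Z := fun x => ¬ LeftZone i x m) e id id (fun _ => id)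
  have out : ∀ {a b : Vtx G} {len : ℕ} {inner : Fin (len - 1) → Vtx G},
      ¬ LeftZone i a m → ¬ LeftZone i b m → (∀ p, ¬ LeftZone i (inner p) m) →
      PathStep a b len inner x z →
      (LeftZone i x m → LeftZone i z (m + 1) ∨
        (reductionGraph G).edist z (.right i (firstIdx i)) ≤ (m + 1 : ℕ)) ∧
      (LeftZone i z m → LeftZone i x (m + 1) ∨
        (reductionGraph G).edist x (.right i (firstIdx i)) ≤ (m + 1 : ℕ)) := by
    intro a b len inner ha hb hi hs
    have hn := PathStep.not_of_forall (Z := fun x => LeftZone i x m) ha hb hi hs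
    exact ⟨fun hx => (hn.1 hx).elim, fun hz => (hn.2 hz).elim⟩
  cases h with
  | line c p q hpq => exact ⟨False.elim, False.elim⟩
  | mid c d => cases d <;> exact ⟨False.elim, False.elim⟩
  | leaf c d b => exact ⟨False.elim, False.elim⟩
  | anchor c k x z hs => exact out id id (fun _ => id) hs
  | left k x z hs => exact leftZone_left_path i k hs m
  | right k x z hs => exact out id id (fun _ => id) hs
  | edge e x z hs => exact out id id (fun _ => id) hs
  | tl e x z hs => exact out (hw e _) id (fun _ => id) hs
  | tr e x z hs => exact out (hw e _) id (fun _ => id) hs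

theorem edist_right_le_edist_left {x : Vtx G} (hx : ∀ m, ¬ LeftZone i x m) :
    (reductionGraph G).edist x (.right i (firstIdx i))
      ≤ (reductionGraph G).edist x (.left i (firstIdx i)) := by
  have h0 : LeftZone (G := G) i (.left i (firstIdx i)) 0 := ⟨rfl, le_rfl⟩
  refine edist_le_of_region _ _ (LeftZone i) h0 ?_ x hx
  intro x z m h hz
  rcases ((SimpleGraph.fromRel_adj _ _ _).1 h).2 with hs | hs
  · exact (leftZone_step i hs m).1 hz
  · exact (leftZone_step i hs m).2 hz

/-- A vertex separating `l^i_1` and `r^i_1` lies in one of the two regions around `i`. -/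
theorem mem_zone_of_dist_ne {x : Vtx G}
    (hx : (reductionGraph G).dist x (.left i (firstIdx i))
      ≠ (reductionGraph G).dist x (.right i (firstIdx i))) :
    ∃ m, Zone i x m ∨ LeftZone i x m := by
  by_contra hc
  push Not at hc
  exact hx (dist_eq_of_edist_le (edist_left_le_edist_right i fun m => (hc m).1)
    (edist_right_le_edist_left i fun m => (hc m).2))

end Closure

/-! ### Assigning vertices of `G` to vertices of the constructed graph -/

/-- Every vertex of `G'` belongs to a vertex of `G` that dominates each `i` whose pair
`l^i_1, r^i_1` it may separate. -/
theorem exists_home (i₀ : Fin n) (x : Vtx G) :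
    ∃ k : Fin n, ∀ i m, Zone i x m ∨ LeftZone i x m → k = i ∨ G.Adj i k := by
  have hy := yLen_bounds i₀
  cases x with
  | line c p => exact ⟨i₀, fun i m h => (h.elim id id).elim⟩
  | mid c d => exact ⟨i₀, fun i m h => (h.elim id id).elim⟩
  | leaf c d b => exact ⟨i₀, fun i m h => (h.elim id id).elim⟩
  | anchor c k => exact ⟨k, fun i m h => Or.inr (h.resolve_right id).1⟩
  | anchorInner c k p => exact ⟨k, fun i m h => Or.inr (h.resolve_right id).1⟩
  | left k q => exact ⟨k, fun i m h => h.elim (fun h => Or.inr h.1) (fun h => Or.inl h.1)⟩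
  | right k q =>
    exact ⟨k, fun i m h => (h.resolve_right id).elim (fun h => Or.inl h.1) (fun h => Or.inr h.1)⟩
  | edgeInner e p =>
    have hl := e.len_eq
    have hlt := e.mul_add_le
    -- The segments of length `y` at the two ends serve the neighbours of different ends of `e`.
    -- They are disjoint, so one end suffices as home; in the middle either end would do.
    by_cases hp : p.val + 1 < yLen n
    · refine ⟨e.i, fun i m h => ?_⟩
      rcases h.resolve_right id with ⟨rfl, _⟩ | ⟨rfl, _⟩ | ⟨h, _⟩ | ⟨_, h, _⟩
      · exact Or.inl rfl
      · exact Or.inr e.adj.symm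
      · exact Or.inr h
      · omega
    · refine ⟨e.j, fun i m h => ?_⟩
      rcases h.resolve_right id with ⟨rfl, _⟩ | ⟨rfl, _⟩ | ⟨_, h, _⟩ | ⟨h, _⟩
      · exact Or.inr e.adj
      · exact Or.inl rfl
      · exact absurd h hp
      · exact Or.inr h
  | tlInner e p =>
    refine ⟨e.i, fun i m h => ?_⟩
    rcases h.resolve_right id with ⟨rfl, _⟩ | ⟨rfl, _⟩
    · exact Or.inl rfl
    · exact Or.inr e.adj.symm
  | trInner e p =>
    refine ⟨e.i, fun i m h => ?_⟩
    rcases h.resolve_right id with ⟨rfl, _⟩ | ⟨rfl, _⟩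
    · exact Or.inl rfl
    · exact Or.inr e.adj.symm

/-! ### Twin leaves -/

section Twins

theorem step_leaf {x z : Vtx G} {c : Line} {d : Side} {b : Bool} (h : Step G x z) :
    (x = .leaf c d b → False) ∧ (z = .leaf c d b → x = .mid c d) := by
  have hw : ∀ (e : GEdge G) (p : ℕ), ¬ (Vtx.edgePoint e p = .leaf c d b) :=
    fun e => edgePoint_cases (Z := fun x => ¬ (x = .leaf c d b)) e
      (by simp) (by simp) (by simp)
  have out : ∀ {a b' : Vtx G} {len : ℕ} {inner : Fin (len - 1) → Vtx G},
      a ≠ .leaf c d b → b' ≠ .leaf c d b → (∀ p, inner p ≠ .leaf c d b) →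
      PathStep a b' len inner x z →
      (x = .leaf c d b → False) ∧ (z = .leaf c d b → x = .mid c d) := by
    intro a b' len inner ha hb hi hs
    have := PathStep.not_of_forall (Z := fun x => x = .leaf c d b) ha hb hi hs
    exact ⟨this.1, fun h => (this.2 h).elim⟩
  cases h with
  | line c p q hpq => simp
  | mid c d => cases d <;> simp [Vtx.endpoint]
  | leaf c d b => exact ⟨by simp, fun h => by cases h; rfl⟩
  | anchor c k x z hs => refine out ?_ ?_ ?_ hs <;> simp [Vtx.u]
  | left k x z hs => refine out ?_ ?_ ?_ hs <;> simp
  | right k x z hs => refine out ?_ ?_ ?_ hs <;> simp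
  | edge e x z hs => refine out ?_ ?_ ?_ hs <;> simp
  | tl e x z hs => refine out (hw e _) ?_ ?_ hs <;> simp [Vtx.u1]
  | tr e x z hs => refine out (hw e _) ?_ ?_ hs <;> simp [Vtx.u2]

theorem edist_leaf_le (c : Line) (d : Side) (b b' : Bool) {x : Vtx G} (hx : x ≠ .leaf c d b) :
    (reductionGraph G).edist x (.leaf c d b') ≤ (reductionGraph G).edist x (.leaf c d b) := by
  -- The region is the single leaf: its only exit is the middle vertex, which is adjacent to the
  -- other leaf too.
  refine edist_le_of_region _ _ (fun x _ => x = .leaf c d b) rfl ?_ x (fun _ => hx)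
  intro x z m h hz
  right
  have hzm : z = .mid c d := by
    rcases ((SimpleGraph.fromRel_adj _ _ _).1 h).2 with hs | hs
    · exact ((step_leaf hs).1 hz).elim
    · exact (step_leaf hs).2 hz
  subst hzm
  exact (edist_le_one_of_step (Step.leaf c d b')).trans (by exact_mod_cast (by omega : 1 ≤ m + 1))

/-- A metric basis contains a leaf of each of the four `P₃`s. -/
theorem IsMetricBasis.exists_leaf_mem {L : Finset (Vtx G)}
    (hL : IsMetricBasis (reductionGraph G) L) (c : Line) (d : Side) :
    ∃ b, Vtx.leaf c d b ∈ L := by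
  obtain ⟨x, hx, hne⟩ := hL (.leaf c d true) (.leaf c d false) (by simp)
  by_contra hc
  push Not at hc
  have h : ∀ b, x ≠ .leaf c d b := fun b hb => hc b (hb ▸ hx)
  exact hne (dist_eq_of_edist_le (edist_leaf_le c d false true (h _))
    (edist_leaf_le c d true false (h _)))

end Twins

/-! ### From a metric basis to a dominating set -/

theorem exists_dominatingSet_of_isMetricBasis {L : Finset (Vtx G)}
    (hL : IsMetricBasis (reductionGraph G) L) {h : ℕ} (hcard : L.card ≤ h + 4) :
    ∃ D : Finset (Fin n), D.card ≤ h ∧ IsDominatingSet G D := by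
  classical
  rcases isEmpty_or_nonempty (Fin n) with hn | ⟨⟨i₀⟩⟩
  · exact ⟨∅, by simp, fun x => hn.elim x⟩
  choose home hhome using exists_home (G := G) i₀
  choose b hb using hL.exists_leaf_mem
  let T : Finset (Vtx G) := {.leaf .t .l (b .t .l), .leaf .t .r (b .t .r),
    .leaf .b .l (b .b .l), .leaf .b .r (b .b .r)}
  have hT : T ⊆ L := by
    intro x hx
    simp only [T, Finset.mem_insert, Finset.mem_singleton] at hx
    rcases hx with rfl | rfl | rfl | rfl <;> exact hb _ _
  have hTcard : T.card = 4 := by simp [T]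
  -- Discarding one leaf per line end leaves at most `h` vertices; a second leaf that stays in `L`
  -- only contributes a superfluous home.
  refine ⟨(L \ T).image home, ?_, fun i => ?_⟩
  · refine Finset.card_image_le.trans ?_
    rw [Finset.card_sdiff_of_subset hT]
    omega
  · obtain ⟨x, hx, hne⟩ := hL (.left i (firstIdx i)) (.right i (firstIdx i)) (by simp)
    obtain ⟨m, hm⟩ := mem_zone_of_dist_ne i hne
    refine ⟨home x, Finset.mem_image_of_mem _ (Finset.mem_sdiff.2 ⟨hx, fun hxT => ?_⟩),
      hhome x i m hm⟩
    simp only [T, Finset.mem_insert, Finset.mem_singleton] at hxT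
    rcases hxT with rfl | rfl | rfl | rfl <;> exact hm.elim id id

end MetricDim

theorem mainTheorem4 {V : Type*} (G : SimpleGraph V) (V₁ V₂ : Set V)
    (hG : G.IsBipartiteWith V₁ V₂)
    (n s : ℕ) (v : Fin n ≃ V)
    (hV₁ : V₁ = {x | ∃ i : Fin n, i.val < s ∧ v i = x})
    (hV₂ : V₂ = {x | ∃ i : Fin n, s ≤ i.val ∧ v i = x})
    (hgap : ∀ i j : Fin n, i < j → G.Adj (v i) (v j) → i.val + 3 ≤ j.val)
    (h : ℕ) (hh : 1 ≤ h)
    (hyes : MetricDim.MetricDimensionYes (MetricDim.reductionGraph (G.comap v)) (h + 4)) :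
    MetricDim.DominatingSetYes G h := by
  obtain ⟨L, hcard, hL⟩ := hyes
  obtain ⟨D, hD, hdom⟩ := MetricDim.exists_dominatingSet_of_isMetricBasis hL hcard
  refine ⟨D.map v.toEmbedding, by rwa [Finset.card_map], fun x => ?_⟩
  obtain ⟨d, hd, hx⟩ := hdom (v.symm x)
  refine ⟨v d, Finset.mem_map_of_mem _ hd, ?_⟩
  rcases hx with hx | hx
  · exact Or.inl (by rw [hx, v.apply_symm_apply])
  · exact Or.inr (by simpa using hx)
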